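/- Let $N\ge 1$ and let $V_N$ be a random matrix in the unitary group $U(N)$ distributed according to the Haar probability measure $\mu_{U(N)}$. Then for every $\theta\in\mathbb R$ $$ \det\bigl(I_N-e^{i\theta}V_N\bigr)\ \overset{\text{law}}{=}\ \prod_{k=1}^N\Bigl(1+e^{i\theta_k}\sqrt{\beta_{1,k-1}}\Bigr), $$ where $\theta_1,\dots,\theta_N,\beta_{1,0},\dots,\beta_{1,N-1}$ are (jointly) independent real random variables, each $\theta_k$ is uniformly distributed on $[0,2\pi]$, and, for $0\le j\le N-1$, $\beta_{1,j}$ has the beta distribution with parameters $1$ and $j$; by convention $\beta_{1,0}$ has the Dirac distribution at $1$. -/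

import Mathlib

open MeasureTheory ProbabilityTheory

/-- The Borel σ-algebra of the unitary group `U(N)`. -/
noncomputable instance unitaryGroupMeasurableSpace (N : ℕ) :
    MeasurableSpace (Matrix.unitaryGroup (Fin N) ℂ) :=
  borel _

instance unitaryGroupBorelSpace (N : ℕ) :
    BorelSpace (Matrix.unitaryGroup (Fin N) ℂ) :=
  ⟨rfl⟩

/-- The law of `β_{1,j}`: the beta distribution with parameters `1` and `j` for `j ≥ 1`,
and the Dirac mass at `1` for `j = 0`. -/
noncomputable def betaOneLaw (j : ℕ) : Measure ℝ :=
  if j = 0 then Measure.dirac 1 else betaMeasure 1 (j : ℝ)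

/-! The law of `det (1 - V)` satisfies a recursion in the dimension. By left invariance a Haar
matrix `H` of U(n+1) may be replaced by `diag(1, V) H`, with `V` Haar on U(n) independent of `H`.
With `a = H₀₀`, a Schur complement gives `det (1 - diag(1, V) H) = (1 - a) det (1 - W V)`, where `W
= D + (1 - a)⁻¹ C B` is again unitary and depends on `H` alone. Left invariance of `V` absorbs `W`,
leaving `(1 - a) det (1 - V)` with independent factors (`lintegral_det_one_sub_haar_succ`).

It remains to find the law of `1 - a`. The first row of `H` is distributed like a normalized complex
Gaussian vector, so `|a|²` is Beta(1, n): the `|zᵢ|²` are independent exponentials. Invariance under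
scalars of modulus one makes the phase of `a` uniform and independent of `|a|`
(`lintegral_one_sub_haar_apply_zero`). The same scalar invariance removes `e^{iθ}` from the theorem.
-/

open scoped ENNReal

/-! ### Schur complements of block unitary matrices -/

open Matrix in
/-- The closed-loop matrix `D + C (1 - a)⁻¹ B` of a unitary block matrix is unitary. -/
theorem conjTranspose_mul_self_schur_eq_one {n : Type*} [Fintype n] [DecidableEq n]
    {a : ℂ} {B : Matrix Unit n ℂ} {C : Matrix n Unit ℂ} {D : Matrix n n ℂ} (ha : a ≠ 1)
    (h : (fromBlocks (a • 1) B C D)ᴴ * fromBlocks (a • 1) B C D = 1) :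
    (D + (1 - a)⁻¹ • (C * B))ᴴ * (D + (1 - a)⁻¹ • (C * B)) = 1 := by
  rw [fromBlocks_conjTranspose, fromBlocks_multiply, ← fromBlocks_one, fromBlocks_inj] at h
  obtain ⟨h1, h2, h3, h4⟩ := h
  simp only [conjTranspose_smul, conjTranspose_one, mul_smul_comm, mul_one, Matrix.one_mul, Matrix.mul_one, Matrix.smul_mul, Matrix.mul_smul] at h1 h2 h3
  have e1 : Cᴴ * C = (1 - star a * a) • (1 : Matrix Unit Unit ℂ) := by
    rw [eq_sub_of_add_eq' h1, sub_smul, one_smul, smul_smul, mul_comm]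
  have e2 : Cᴴ * D = (-star a) • B := by rw [neg_smul]; exact eq_neg_of_add_eq_zero_right h2
  have e3 : Dᴴ * C = (-a) • Bᴴ := by rw [neg_smul]; exact eq_neg_of_add_eq_zero_right h3
  have e4 : Dᴴ * D = 1 - Bᴴ * B := eq_sub_of_add_eq' h4
  have n1 : 1 - a ≠ 0 := sub_ne_zero.2 (Ne.symm ha)
  have n2 : 1 - star a ≠ 0 := by
    intro h0; apply n1; have := congrArg star h0; simpa using this
  -- After expansion everything beyond `1 - BᴴB` is a multiple of `BᴴB`; this is the statement that
  -- the coefficients sum to one.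
  have key : (-a) * (1 - a)⁻¹ + (-star a) * (1 - star a)⁻¹ +
      (1 - star a * a) * ((1 - a)⁻¹ * (1 - star a)⁻¹) = 1 := by
    field_simp; ring
  have hs : star (1 - a)⁻¹ = (1 - star a)⁻¹ := by simp
  have t1 : Dᴴ * (C * B) = (-a) • (Bᴴ * B) := by rw [← Matrix.mul_assoc, e3, Matrix.smul_mul]
  have t2 : Bᴴ * Cᴴ * D = (-star a) • (Bᴴ * B) := by rw [Matrix.mul_assoc, e2, Matrix.mul_smul]
  have t3 : Bᴴ * Cᴴ * (C * B) = (1 - star a * a) • (Bᴴ * B) := by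
    rw [Matrix.mul_assoc, ← Matrix.mul_assoc Cᴴ, e1]; simp
  rw [conjTranspose_add, conjTranspose_smul, conjTranspose_mul, Matrix.add_mul, Matrix.mul_add,
    Matrix.mul_add, Matrix.mul_smul, Matrix.smul_mul, Matrix.smul_mul, Matrix.mul_smul, t1, t2, t3,
    e4, hs]
  have : (1 - a)⁻¹ • -a • (Bᴴ * B) + ((1 - star a)⁻¹ • -star a • (Bᴴ * B) +
      (1 - star a)⁻¹ • (1 - a)⁻¹ • (1 - star a * a) • (Bᴴ * B)) = Bᴴ * B := by
    simp only [smul_smul, ← add_smul]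
    convert one_smul ℂ (Bᴴ * B) using 2
    linear_combination key
  calc _ = 1 - Bᴴ * B + ((1 - a)⁻¹ • -a • (Bᴴ * B) + ((1 - star a)⁻¹ • -star a • (Bᴴ * B) +
      (1 - star a)⁻¹ • (1 - a)⁻¹ • (1 - star a * a) • (Bᴴ * B))) := by abel
    _ = 1 := by rw [this]; abel

-- Take the Schur complement of the scalar block `1 - a`, then move `V` to the right by `det (1 -
-- XY) = det (1 - YX)`.
open Matrix in
theorem det_one_sub_fromBlocks_mul {n : Type*} [Fintype n] [DecidableEq n]
    {a : ℂ} {B : Matrix Unit n ℂ} {C : Matrix n Unit ℂ} {D : Matrix n n ℂ} (ha : a ≠ 1)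
    (V : Matrix n n ℂ) :
    (1 - fromBlocks 1 0 0 V * fromBlocks (a • 1) B C D).det =
      (1 - a) * (1 - (D + (1 - a)⁻¹ • (C * B)) * V).det := by
  have n1 : 1 - a ≠ 0 := sub_ne_zero.2 (Ne.symm ha)
  have hinv : ((1 - a) • (1 : Matrix Unit Unit ℂ)) * ((1 - a)⁻¹ • (1 : Matrix Unit Unit ℂ)) = 1 := by
    rw [smul_mul_smul_comm, mul_inv_cancel₀ n1, one_smul, Matrix.one_mul]
  let _ : Invertible ((1 - a) • (1 : Matrix Unit Unit ℂ)) := invertibleOfRightInverse _ _ hinv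
  have hb : 1 - fromBlocks 1 0 0 V * fromBlocks (a • 1) B C D =
      fromBlocks ((1 - a) • 1) (-B) (-(V * C)) (1 - V * D) := by
    rw [fromBlocks_multiply, ← fromBlocks_one, sub_eq_add_neg, fromBlocks_neg, fromBlocks_add]
    congr 1 <;> simp [sub_eq_add_neg, add_smul]
  rw [hb, det_fromBlocks₁₁, invOf_eq_right_inv hinv, det_one_sub_mul_comm _ V]
  congr 1
  · simp
  · congr 1
    simp [Matrix.mul_add, Matrix.mul_assoc, sub_sub]

open Matrix ComplexOrder in
theorem det_one_sub_fromBlocks_mul_of_eq_one {n : Type*} [Fintype n] [DecidableEq n]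
    {B : Matrix Unit n ℂ} {C : Matrix n Unit ℂ} {D : Matrix n n ℂ}
    (h : (fromBlocks 1 B C D)ᴴ * fromBlocks 1 B C D = 1) (V : Matrix n n ℂ) :
    (1 - fromBlocks 1 0 0 V * fromBlocks 1 B C D).det = 0 := by
  rw [fromBlocks_conjTranspose, fromBlocks_multiply, ← fromBlocks_one, fromBlocks_inj] at h
  have hC : C = 0 := by
    rw [← Matrix.conjTranspose_mul_self_eq_zero]
    simpa using h.1
  apply det_eq_zero_of_column_eq_zero (Sum.inl ())
  rw [fromBlocks_multiply, ← fromBlocks_one, sub_eq_add_neg, fromBlocks_neg, fromBlocks_add, hC]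
  rintro (i | i) <;> simp

/-! ### The embedding of U(n) in U(n+1) -/

/-- The bijection `Unit ⊕ Fin n ≃ Fin (n + 1)` sending the point of `Unit` to `0`. -/
def unitSumFinEquiv (n : ℕ) : Unit ⊕ Fin n ≃ Fin (n + 1) where
  toFun := Sum.elim (fun _ => 0) Fin.succ
  invFun := Fin.cases (Sum.inl ()) Sum.inr
  left_inv := by rintro (i | i) <;> simp
  right_inv := by intro i; induction i using Fin.cases <;> simp

/-- The matrix `diag(1, V)` of size `n + 1`. -/
noncomputable def oneBlock {n : ℕ} (V : Matrix (Fin n) (Fin n) ℂ) :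
    Matrix (Fin (n + 1)) (Fin (n + 1)) ℂ :=
  (Matrix.fromBlocks 1 0 0 V).submatrix (unitSumFinEquiv n).symm (unitSumFinEquiv n).symm

theorem oneBlock_mem_unitaryGroup {n : ℕ} {V : Matrix (Fin n) (Fin n) ℂ}
    (hV : V ∈ Matrix.unitaryGroup (Fin n) ℂ) :
    oneBlock V ∈ Matrix.unitaryGroup (Fin (n + 1)) ℂ := by
  rw [Matrix.mem_unitaryGroup_iff', Matrix.star_eq_conjTranspose] at *
  rw [oneBlock, Matrix.conjTranspose_submatrix, Matrix.submatrix_mul_equiv,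
    Matrix.fromBlocks_conjTranspose, Matrix.fromBlocks_multiply]
  simp [hV, Matrix.fromBlocks_one]

/-- The embedding of `U(n)` in `U(n + 1)` as the stabilizer of the first basis vector. -/
noncomputable def unitaryOneBlock {n : ℕ} (V : Matrix.unitaryGroup (Fin n) ℂ) :
    Matrix.unitaryGroup (Fin (n + 1)) ℂ :=
  ⟨oneBlock V, oneBlock_mem_unitaryGroup V.2⟩

theorem continuous_unitaryOneBlock {n : ℕ} : Continuous (unitaryOneBlock (n := n)) := by
  refine Continuous.subtype_mk ?_ _
  exact (Continuous.matrix_fromBlocks continuous_const continuous_const continuous_const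
    continuous_subtype_val).matrix_submatrix _ _

/-- The order of quantifiers is the point: `W` does not depend on `V`, so invariance of the Haar
measure in `V` can absorb it. If `H₀₀ = 1` both sides vanish and any `W` serves. -/
theorem exists_det_one_sub_unitaryOneBlock_mul {n : ℕ}
    (H : Matrix.unitaryGroup (Fin (n + 1)) ℂ) :
    ∃ W : Matrix.unitaryGroup (Fin n) ℂ, ∀ V : Matrix.unitaryGroup (Fin n) ℂ,
      (1 - (unitaryOneBlock V * H : Matrix.unitaryGroup (Fin (n + 1)) ℂ).1).det =
        (1 - H.1 0 0) * (1 - (W * V : Matrix.unitaryGroup (Fin n) ℂ).1).det := by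
  set e := unitSumFinEquiv n with he
  set M := H.1.submatrix e e with hM
  have hMu : M.conjTranspose * M = 1 := by
    have := H.2
    rw [Matrix.mem_unitaryGroup_iff', Matrix.star_eq_conjTranspose] at this
    rw [hM, Matrix.conjTranspose_submatrix, Matrix.submatrix_mul_equiv, this,
      Matrix.submatrix_one_equiv]
  have hblocks : M = Matrix.fromBlocks (H.1 0 0 • 1) M.toBlocks₁₂ M.toBlocks₂₁ M.toBlocks₂₂ := by
    conv_lhs => rw [← Matrix.fromBlocks_toBlocks M]
    congr 1
    ext i j
    simp [Matrix.toBlocks₁₁, hM, he, unitSumFinEquiv]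
  have hdet (V : Matrix.unitaryGroup (Fin n) ℂ) :
      (1 - (unitaryOneBlock V * H : Matrix.unitaryGroup (Fin (n + 1)) ℂ).1).det =
        (1 - Matrix.fromBlocks 1 0 0 V.1 * M).det := by
    rw [← Matrix.det_submatrix_equiv_self e]
    congr 1
    rw [Matrix.submatrix_sub, Pi.sub_apply, Pi.sub_apply, Matrix.submatrix_one_equiv]
    congr 1
    change (oneBlock V.1 * H.1).submatrix e e = _
    rw [← Matrix.submatrix_mul_equiv _ _ e e e, oneBlock, Matrix.submatrix_submatrix]
    simp [he, hM]
  rw [hblocks] at hMu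
  by_cases ha : H.1 0 0 = 1
  · refine ⟨1, fun V => ?_⟩
    rw [hdet, hblocks, ha, sub_self, zero_mul, one_smul]
    rw [ha, one_smul] at hMu
    exact det_one_sub_fromBlocks_mul_of_eq_one hMu _
  · refine ⟨⟨_, Matrix.mem_unitaryGroup_iff'.2 (conjTranspose_mul_self_schur_eq_one ha hMu)⟩,
      fun V => ?_⟩
    rw [hdet]
    exact (congrArg (fun M' => (1 - Matrix.fromBlocks 1 0 0 V.1 * M').det) hblocks).trans
      (det_one_sub_fromBlocks_mul ha V.1)

/-! ### Haar measure on U(N) and the determinant recursion -/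

instance unitaryGroup_secondCountableTopology (N : ℕ) :
    SecondCountableTopology (Matrix.unitaryGroup (Fin N) ℂ) :=
  haveI : SecondCountableTopology (Matrix (Fin N) (Fin N) ℂ) :=
    inferInstanceAs (SecondCountableTopology (Fin N → Fin N → ℂ))
  Topology.IsInducing.subtypeVal.secondCountableTopology

instance unitaryGroup_compactSpace (N : ℕ) : CompactSpace (Matrix.unitaryGroup (Fin N) ℂ) := by
  suffices h : IsCompact (Matrix.unitaryGroup (Fin N) ℂ : Set (Matrix (Fin N) (Fin N) ℂ)) from
    isCompact_iff_compactSpace.1 h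
  have hK : IsCompact (Set.univ.pi fun _ : Fin N => Set.univ.pi fun _ : Fin N =>
      Metric.closedBall (0 : ℂ) 1) :=
    isCompact_univ_pi fun _ => isCompact_univ_pi fun _ => isCompact_closedBall _ _
  refine hK.of_isClosed_subset ?_ fun U hU i _ j _ => ?_
  · have : (Matrix.unitaryGroup (Fin N) ℂ : Set (Matrix (Fin N) (Fin N) ℂ)) =
        {U | U * star U = 1} := by
      ext U; exact Matrix.mem_unitaryGroup_iff
    rw [this]
    exact isClosed_eq (continuous_id.matrix_mul continuous_star) continuous_const
  · simpa using entry_norm_bound_of_unitary hU i j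

theorem exists_isHaarMeasure_isProbabilityMeasure_unitaryGroup (N : ℕ) :
    ∃ μ : Measure (Matrix.unitaryGroup (Fin N) ℂ), μ.IsHaarMeasure ∧ IsProbabilityMeasure μ :=
  ⟨Measure.haarMeasure ⊤, inferInstance, ⟨Measure.haarMeasure_self⟩⟩

theorem measurable_det_one_sub (N : ℕ) :
    Measurable fun U : Matrix.unitaryGroup (Fin N) ℂ => (1 - U.1).det :=
  (Continuous.matrix_det (continuous_const.sub continuous_subtype_val)).measurable

theorem measurable_unitaryGroup_apply {N : ℕ} (i j : Fin N) :
    Measurable fun U : Matrix.unitaryGroup (Fin N) ℂ => U.1 i j :=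
  (continuous_subtype_val.matrix_elem i j).measurable

/-- Under the Haar measures, `det (1 - H)` for `H ∈ U(n + 1)` has the law of
`(1 - H₀₀) det (1 - V)` with `V ∈ U(n)` independent of `H`. -/
theorem lintegral_det_one_sub_haar_succ {n : ℕ}
    (μ : Measure (Matrix.unitaryGroup (Fin (n + 1)) ℂ)) [μ.IsHaarMeasure] [IsProbabilityMeasure μ]
    (ν : Measure (Matrix.unitaryGroup (Fin n) ℂ)) [ν.IsHaarMeasure] [IsProbabilityMeasure ν]
    {F : ℂ → ℝ≥0∞} (hF : Measurable F) :
    ∫⁻ H, F (1 - H.1).det ∂μ = ∫⁻ H, ∫⁻ V, F ((1 - H.1 0 0) * (1 - V.1).det) ∂ν ∂μ := by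
  calc ∫⁻ H, F (1 - H.1).det ∂μ
      = ∫⁻ _ : Matrix.unitaryGroup (Fin n) ℂ, ∫⁻ H, F (1 - H.1).det ∂μ ∂ν := by simp
    _ = ∫⁻ V, ∫⁻ H, F (1 - (unitaryOneBlock V * H).1).det ∂μ ∂ν := by
        refine lintegral_congr fun V => ?_
        exact (lintegral_mul_left_eq_self (μ := μ) (fun H => F (1 - H.1).det) _).symm
    _ = ∫⁻ H, ∫⁻ V, F (1 - (unitaryOneBlock V * H).1).det ∂ν ∂μ := by
        rw [lintegral_lintegral_swap]
        refine Measurable.aemeasurable ?_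
        refine hF.comp ((measurable_det_one_sub _).comp ?_)
        exact (Continuous.mul (continuous_unitaryOneBlock.comp continuous_fst)
          continuous_snd).measurable
    _ = ∫⁻ H, ∫⁻ V, F ((1 - H.1 0 0) * (1 - V.1).det) ∂ν ∂μ := by
        refine lintegral_congr fun H => ?_
        obtain ⟨W, hW⟩ := exists_det_one_sub_unitaryOneBlock_mul H
        simp_rw [hW]
        exact lintegral_mul_left_eq_self (μ := ν) (fun V => F ((1 - H.1 0 0) * (1 - V.1).det)) W

/-! ### Complex Gaussian vectors -/

theorem lintegral_fin_prod_eq_prod_lintegral {α : Type*} [MeasurableSpace α] {n : ℕ}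
    (μ : Fin n → Measure α) [∀ i, SigmaFinite (μ i)] {f : Fin n → α → ℝ≥0∞}
    (hf : ∀ i, Measurable (f i)) :
    ∫⁻ z, ∏ i, f i (z i) ∂(Measure.pi μ) = ∏ i, ∫⁻ x, f i x ∂(μ i) := by
  induction n with
  | zero => simp [Measure.pi_of_empty μ]
  | succ n ih =>
    have hm : Measurable fun z : Fin (n + 1) → α => ∏ i, f i (z i) :=
      Finset.measurable_fun_prod _ fun i _ => (hf i).comp (measurable_pi_apply i)
    rw [← ((measurePreserving_piFinSuccAbove μ 0).symm).lintegral_comp hm,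
      Fin.prod_univ_succ, ← ih (fun i => μ i.succ) fun i => hf i.succ]
    rw [← lintegral_prod_mul (hf 0).aemeasurable]
    · refine lintegral_congr fun x => ?_
      rw [Fin.prod_univ_succ]
      simp [MeasurableEquiv.piFinSuccAbove]
    · exact (Finset.measurable_fun_prod _ fun i _ =>
        (hf i.succ).comp (measurable_pi_apply i)).aemeasurable

theorem pi_withDensity {α : Type*} [MeasurableSpace α] {n : ℕ}
    (μ : Measure α) [SigmaFinite μ] {f : α → ℝ≥0∞} (hf : Measurable f)
    [SigmaFinite (μ.withDensity f)] :
    Measure.pi (fun _ : Fin n => μ.withDensity f) =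
      (Measure.pi fun _ : Fin n => μ).withDensity fun z => ∏ i, f (z i) := by
  refine (Measure.pi_eq fun s hs => ?_)
  rw [withDensity_apply _ (MeasurableSet.univ_pi hs), Measure.restrict_pi_pi,
    lintegral_fin_prod_eq_prod_lintegral _ fun _ => hf]
  exact Finset.prod_congr rfl fun i _ => (withDensity_apply _ (hs i)).symm

/-- In polar coordinates the radial integrand `x e^{-bx²}` has primitive `-e^{-bx²} / (2b)`, and the
angle contributes `2π`. -/
theorem setLIntegral_exp_neg_mul_norm_sq {b r : ℝ} (hb : 0 < b) (hr : 0 ≤ r) :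
    ∫⁻ z in {z : ℂ | r ≤ ‖z‖ ^ 2}, ENNReal.ofReal (Real.exp (-b * ‖z‖ ^ 2)) =
      ENNReal.ofReal (Real.pi / b * Real.exp (-b * r)) := by
  have hrad : ∫⁻ x in Set.Ioi (√r), ENNReal.ofReal (x * Real.exp (-b * x ^ 2)) =
      ENNReal.ofReal (Real.exp (-b * r) / (2 * b)) := by
    have hderiv : ∀ x ∈ Set.Ici (√r), HasDerivAt (fun x : ℝ => -(Real.exp (-b * x ^ 2) / (2 * b)))
        (x * Real.exp (-b * x ^ 2)) x := by
      intro x _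
      have := (((((hasDerivAt_id x).pow 2).const_mul (-b)).exp).div_const (2 * b)).neg
      convert! this using 1
      simp; field_simp
    have hpos : ∀ x ∈ Set.Ioi (√r), 0 ≤ x * Real.exp (-b * x ^ 2) := fun x hx =>
      mul_nonneg ((Real.sqrt_nonneg r).trans hx.le) (Real.exp_pos _).le
    have hlim : Filter.Tendsto (fun x : ℝ => -(Real.exp (-b * x ^ 2) / (2 * b))) Filter.atTop
        (nhds 0) := by
      have h1 : Filter.Tendsto (fun x : ℝ => -b * x ^ 2) Filter.atTop Filter.atBot :=
        (Filter.tendsto_pow_atTop two_ne_zero).const_mul_atTop_of_neg (neg_lt_zero.2 hb)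
      simpa using ((Real.tendsto_exp_atBot.comp h1).div_const (2 * b)).neg
    rw [← ofReal_integral_eq_lintegral_ofReal
      (integrableOn_Ioi_deriv_of_nonneg' hderiv hpos hlim)
      ((ae_restrict_iff' measurableSet_Ioi).2 (Filter.Eventually.of_forall hpos)),
      integral_Ioi_of_hasDerivAt_of_nonneg' hderiv hpos hlim, Real.sq_sqrt hr]
    simp
  have hS : MeasurableSet {z : ℂ | r ≤ ‖z‖ ^ 2} :=
    measurableSet_le measurable_const (measurable_norm.pow_const 2)
  rw [← lintegral_indicator hS, ← Complex.lintegral_comp_polarCoord_symm, polarCoord_target,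
    Measure.volume_eq_prod, ← Measure.prod_restrict]
  have hcongr : ∫⁻ p : ℝ × ℝ, ENNReal.ofReal p.1 • Set.indicator {z : ℂ | r ≤ ‖z‖ ^ 2}
        (fun z => ENNReal.ofReal (Real.exp (-b * ‖z‖ ^ 2))) (Complex.polarCoord.symm p)
        ∂((volume.restrict (Set.Ioi 0)).prod (volume.restrict (Set.Ioo (-Real.pi) Real.pi))) =
      ∫⁻ p : ℝ × ℝ, Set.indicator (Set.Ici (√r))
        (fun x => ENNReal.ofReal (x * Real.exp (-b * x ^ 2))) p.1 * 1
        ∂((volume.restrict (Set.Ioi 0)).prod (volume.restrict (Set.Ioo (-Real.pi) Real.pi))) := by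
    rw [Measure.prod_restrict]
    refine setLIntegral_congr_fun (measurableSet_Ioi.prod measurableSet_Ioo) ?_
    rintro ⟨x, y⟩ ⟨hx, -⟩
    have hx' : 0 < x := hx
    simp only [Set.indicator, Set.mem_ofPred_eq, Set.mem_Ici, Complex.norm_polarCoord_symm, sq_abs,
      Real.sqrt_le_left hx'.le, smul_eq_mul, mul_one]
    split_ifs
    · rw [ENNReal.ofReal_mul hx'.le]
    · simp
  have hm : Measurable fun x : ℝ => ENNReal.ofReal (x * Real.exp (-b * x ^ 2)) := by fun_prop
  rw [hcongr, lintegral_prod_mul (hm.indicator measurableSet_Ici).aemeasurable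
    measurable_const.aemeasurable, lintegral_indicator measurableSet_Ici,
    Measure.restrict_restrict measurableSet_Ici]
  have hae : (Set.Ici (√r) ∩ Set.Ioi 0 : Set ℝ) =ᵐ[volume] Set.Ioi (√r) := by
    have : (Set.Ioi (√r) ∩ Set.Ioi 0 : Set ℝ) = Set.Ioi (√r) :=
      Set.inter_eq_left.2 fun x hx => (Real.sqrt_nonneg r).trans_lt hx
    conv_rhs => rw [← this]
    exact Ioi_ae_eq_Ici.symm.inter Filter.EventuallyEq.rfl
  rw [Measure.restrict_congr_set hae, hrad]
  simp only [lintegral_const, MeasurableSet.univ, Measure.restrict_apply, Set.univ_inter,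
    Real.volume_Ioo, one_mul]
  rw [← ENNReal.ofReal_mul (by positivity)]
  congr 1
  field_simp
  ring

/-- The standard Gaussian measure on `ℂ`, with density `e^{-|z|²} / π`. -/
noncomputable def complexGaussian : Measure ℂ :=
  volume.withDensity fun z => ENNReal.ofReal (Real.exp (-‖z‖ ^ 2) / Real.pi)

/-- Thus `|z|²` is exponential of rate one, the source of the beta laws below. -/
theorem complexGaussian_norm_sq_ge {r : ℝ} (hr : 0 ≤ r) :
    complexGaussian {z | r ≤ ‖z‖ ^ 2} = ENNReal.ofReal (Real.exp (-r)) := by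
  have hS : MeasurableSet {z : ℂ | r ≤ ‖z‖ ^ 2} :=
    measurableSet_le measurable_const (measurable_norm.pow_const 2)
  rw [complexGaussian, withDensity_apply _ hS]
  simp_rw [div_eq_inv_mul, ENNReal.ofReal_mul (inv_nonneg.2 Real.pi_pos.le)]
  rw [lintegral_const_mul _ (by fun_prop)]
  have := setLIntegral_exp_neg_mul_norm_sq one_pos hr
  simp only [neg_mul, one_mul, div_one] at this
  rw [this, ← ENNReal.ofReal_mul (by positivity), inv_mul_cancel_left₀ Real.pi_ne_zero]

instance isProbabilityMeasure_complexGaussian : IsProbabilityMeasure complexGaussian :=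
  ⟨by simpa [sq_nonneg] using complexGaussian_norm_sq_ge le_rfl⟩

theorem lintegral_exp_neg_mul_norm_sq_complexGaussian {c : ℝ} (hc : 0 ≤ c) :
    ∫⁻ z, ENNReal.ofReal (Real.exp (-(c * ‖z‖ ^ 2))) ∂complexGaussian =
      ENNReal.ofReal (1 / (1 + c)) := by
  rw [complexGaussian, lintegral_withDensity_eq_lintegral_mul _ (by fun_prop) (by fun_prop)]
  have := setLIntegral_exp_neg_mul_norm_sq (b := 1 + c) (by positivity) le_rfl
  simp only [sq_nonneg, Set.ofPred_true, Measure.restrict_univ, mul_zero, Real.exp_zero,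
    mul_one] at this
  have h (z : ℂ) : ((fun z : ℂ => ENNReal.ofReal (Real.exp (-‖z‖ ^ 2) / Real.pi)) *
      (fun z : ℂ => ENNReal.ofReal (Real.exp (-(c * ‖z‖ ^ 2))))) z =
      ENNReal.ofReal Real.pi⁻¹ * ENNReal.ofReal (Real.exp (-(1 + c) * ‖z‖ ^ 2)) := by
    rw [Pi.mul_apply, ← ENNReal.ofReal_mul (by positivity), ← ENNReal.ofReal_mul (by positivity)]
    congr 1
    rw [div_mul_eq_mul_div, ← Real.exp_add, div_eq_inv_mul]
    ring_nf
  simp_rw [h]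
  rw [lintegral_const_mul _ (by fun_prop), this, ← ENNReal.ofReal_mul (by positivity)]
  congr 1
  field_simp

instance nullSingletonClass_complexGaussian : NullSingletonClass complexGaussian := by
  unfold complexGaussian; infer_instance

/-- The real determinant of a complex-linear map is the squared modulus of its complex determinant,
here 1. -/
theorem measurePreserving_vecMul_volume {n : ℕ} {H : Matrix (Fin n) (Fin n) ℂ}
    (hH : H ∈ Matrix.unitaryGroup (Fin n) ℂ) :
    MeasurePreserving (fun z : Fin n → ℂ => Matrix.vecMul z H) := by
  have hn : ‖H.det‖ = 1 := by
    have h : H.det ∈ unitary ℂ := Matrix.det_of_mem_unitary hH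
    exact CStarRing.norm_of_mem_unitary h
  have hdet : LinearMap.det ((Matrix.toLin' H.transpose).restrictScalars ℝ) = 1 := by
    rw [LinearMap.det_restrictScalars, LinearMap.det_toLin', Matrix.det_transpose,
      Algebra.norm_complex_apply, Complex.normSq_eq_norm_sq,
      hn, one_pow]
  have hfun : (fun z : Fin n → ℂ => Matrix.vecMul z H) =
      (Matrix.toLin' H.transpose).restrictScalars ℝ := by
    ext z : 1
    simp [Matrix.mulVec_transpose]
  refine ⟨by fun_prop, ?_⟩
  rw [hfun, Measure.map_linearMap_addHaar_eq_smul_addHaar _ (by rw [hdet]; exact one_ne_zero),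
    hdet]
  simp

theorem sum_norm_sq_vecMul {n : ℕ} {H : Matrix (Fin n) (Fin n) ℂ}
    (hH : H ∈ Matrix.unitaryGroup (Fin n) ℂ) (z : Fin n → ℂ) :
    ∑ i, ‖Matrix.vecMul z H i‖ ^ 2 = ∑ i, ‖z i‖ ^ 2 := by
  have key (w : Fin n → ℂ) : ((∑ i, ‖w i‖ ^ 2 : ℝ) : ℂ) = w ⬝ᵥ star w := by
    simp [dotProduct, Complex.mul_conj, Complex.normSq_eq_norm_sq]
  rw [← Complex.ofReal_inj, key, key, Matrix.star_vecMul, ← Matrix.dotProduct_mulVec,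
    Matrix.mulVec_mulVec, ← Matrix.star_eq_conjTranspose, Matrix.mem_unitaryGroup_iff.1 hH,
    Matrix.one_mulVec]

theorem measurePreserving_vecMul_complexGaussian {n : ℕ} {H : Matrix (Fin n) (Fin n) ℂ}
    (hH : H ∈ Matrix.unitaryGroup (Fin n) ℂ) :
    MeasurePreserving (fun z : Fin n → ℂ => Matrix.vecMul z H)
      (Measure.pi fun _ => complexGaussian) (Measure.pi fun _ => complexGaussian) := by
  have hm : Measurable fun z : ℂ => ENNReal.ofReal (Real.exp (-‖z‖ ^ 2) / Real.pi) := by fun_prop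
  have : SigmaFinite (volume.withDensity
      fun z : ℂ => ENNReal.ofReal (Real.exp (-‖z‖ ^ 2) / Real.pi)) :=
    inferInstanceAs (SigmaFinite complexGaussian)
  have hpi : (Measure.pi fun _ : Fin n => complexGaussian) = (volume : Measure (Fin n → ℂ)).withDensity
      fun z => ∏ i, ENNReal.ofReal (Real.exp (-‖z i‖ ^ 2) / Real.pi) := pi_withDensity volume hm
  have hdens (z : Fin n → ℂ) : ∏ i, ENNReal.ofReal (Real.exp (-‖z i‖ ^ 2) / Real.pi) =
      ENNReal.ofReal (Real.exp (-∑ i, ‖z i‖ ^ 2) / Real.pi ^ n) := by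
    rw [← ENNReal.ofReal_prod_of_nonneg fun _ _ => by positivity]
    simp [Finset.prod_div_distrib, ← Real.exp_sum]
  refine ⟨by fun_prop, ?_⟩
  rw [hpi]
  ext s hs
  have hvol := measurePreserving_vecMul_volume hH
  rw [Measure.map_apply (by fun_prop) hs, withDensity_apply _ hs,
    withDensity_apply _ (hvol.measurable hs)]
  simp_rw [hdens]
  rw [← hvol.setLIntegral_comp_preimage hs (by fun_prop)]
  simp_rw [sum_norm_sq_vecMul hH]

/-! ### The corner entry of a Haar matrix -/

theorem exists_unitaryGroup_row_zero {n : ℕ} {u : Fin (n + 1) → ℂ} (hu : ∑ i, ‖u i‖ ^ 2 = 1) :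
    ∃ U : Matrix.unitaryGroup (Fin (n + 1)) ℂ, ∀ j, U.1 0 j = u j := by
  have hv : Orthonormal ℂ (({0} : Set (Fin (n + 1))).domRestrict
      fun _ : Fin (n + 1) => (WithLp.toLp 2 u : EuclideanSpace ℂ (Fin (n + 1)))) := by
    constructor
    · intro i
      simp [EuclideanSpace.norm_eq, hu]
    · intro i j hij
      exact absurd (Subsingleton.elim i j) hij
  obtain ⟨b, hb⟩ := hv.exists_orthonormalBasis_extension_of_card_eq (by simp)
  refine ⟨⟨Matrix.of fun i j => b i j, ?_⟩, fun j => ?_⟩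
  · rw [Matrix.mem_unitaryGroup_iff]
    ext i k
    rw [Matrix.mul_apply, Matrix.one_apply]
    -- The indices are swapped because the inner product is conjugate-linear in its first argument.
    have := orthonormal_iff_ite.1 b.orthonormal k i
    rw [PiLp.inner_apply] at this
    simpa [eq_comm] using this
  · simp [hb 0 rfl]

theorem exists_unitaryGroup_mul_eq_smul {n : ℕ} {c : ℂ} (hc : ‖c‖ = 1) :
    ∃ S : Matrix.unitaryGroup (Fin n) ℂ, ∀ V : Matrix.unitaryGroup (Fin n) ℂ,
      (S * V : Matrix.unitaryGroup (Fin n) ℂ).1 = c • V.1 := by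
  refine ⟨⟨c • 1, ?_⟩, fun V => ?_⟩
  · rw [Matrix.mem_unitaryGroup_iff, star_smul, star_one, smul_mul_smul_comm, mul_one]
    have : c * star c = 1 := by
      simp [Complex.mul_conj, Complex.normSq_eq_norm_sq, hc]
    rw [this, one_smul]
  · change (c • (1 : Matrix (Fin n) (Fin n) ℂ)) * V.1 = _
    rw [smul_mul_assoc, one_mul]

/-- The `(0, 0)` entry of a Haar unitary matrix has the law of the first coordinate of a normalized
complex Gaussian vector. -/
theorem lintegral_haar_apply_zero {n : ℕ}
    (μ : Measure (Matrix.unitaryGroup (Fin (n + 1)) ℂ)) [μ.IsHaarMeasure] [IsProbabilityMeasure μ]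
    {F : ℂ → ℝ≥0∞} (hF : Measurable F) :
    ∫⁻ H, F (H.1 0 0) ∂μ = ∫⁻ z : Fin (n + 1) → ℂ, F (z 0 / (√(∑ i, ‖z i‖ ^ 2) : ℝ))
      ∂(Measure.pi fun _ => complexGaussian) := by
  set Γ : Measure (Fin (n + 1) → ℂ) := Measure.pi fun _ => complexGaussian with hΓ
  have hz : ∀ᵐ z ∂Γ, z 0 ≠ 0 := by
    rw [ae_iff]
    simpa using Measure.pi_hyperplane (fun _ : Fin (n + 1) => complexGaussian) 0 0
  have hq : Measurable fun z : Fin (n + 1) → ℂ => F (z 0 / (√(∑ i, ‖z i‖ ^ 2) : ℝ)) :=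
    hF.comp (by fun_prop)
  calc ∫⁻ H, F (H.1 0 0) ∂μ = ∫⁻ _, ∫⁻ H, F (H.1 0 0) ∂μ ∂Γ := by simp
    _ = ∫⁻ z, ∫⁻ H, F (Matrix.vecMul z H.1 0 / (√(∑ i, ‖z i‖ ^ 2) : ℝ)) ∂μ ∂Γ := by
        -- For fixed `z ≠ 0`, choose `U` with first row `z / |z|`; replacing `H` by `U H` turns the
        -- corner entry into `(z H)₀ / |z|`.
        refine lintegral_congr_ae (hz.mono fun z hz => ?_)
        have hpos : 0 < ∑ i, ‖z i‖ ^ 2 :=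
          Finset.sum_pos' (fun i _ => by positivity) ⟨0, Finset.mem_univ _, by positivity⟩
        obtain ⟨U, hU⟩ := exists_unitaryGroup_row_zero
          (u := fun j => z j / (√(∑ i, ‖z i‖ ^ 2) : ℝ)) (by
            simp only [norm_div, div_pow, ← Finset.sum_div, Complex.norm_real, Real.norm_eq_abs,
              sq_abs, Real.sq_sqrt hpos.le]
            exact div_self hpos.ne')
        simp only
        rw [← lintegral_mul_left_eq_self (μ := μ) (fun H => F (H.1 0 0)) U]
        refine lintegral_congr fun H => ?_
        congr 1
        change (U.1 * H.1) 0 0 = _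
        simp [Matrix.mul_apply, Matrix.vecMul, dotProduct, hU, Finset.sum_div, div_mul_eq_mul_div]
    _ = ∫⁻ H, ∫⁻ z, F (Matrix.vecMul z H.1 0 / (√(∑ i, ‖z i‖ ^ 2) : ℝ)) ∂Γ ∂μ := by
        rw [lintegral_lintegral_swap]
        refine (hF.comp ?_).aemeasurable
        refine Measurable.div ?_ (by fun_prop)
        simp only [Matrix.vecMul, dotProduct]
        refine Finset.measurable_fun_sum _ fun i _ => ?_
        exact ((measurable_pi_apply i).comp measurable_fst).mul
          ((measurable_unitaryGroup_apply i 0).comp measurable_snd)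
    _ = ∫⁻ _ : Matrix.unitaryGroup (Fin (n + 1)) ℂ,
          ∫⁻ z, F (z 0 / (√(∑ i, ‖z i‖ ^ 2) : ℝ)) ∂Γ ∂μ := by
        -- Now `H` is fixed, and `z H` has the law and the norm of `z`.
        refine lintegral_congr fun H => ?_
        rw [← (measurePreserving_vecMul_complexGaussian H.2).lintegral_comp hq]
        simp_rw [sum_norm_sq_vecMul H.2]
        rfl
    _ = _ := by simp

/-! ### Beta laws from Gaussian ratios -/

theorem betaOneLaw_succ_Ici (m : ℕ) {s : ℝ} (h0 : 0 ≤ s) (h1 : s ≤ 1) :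
    betaOneLaw (m + 1) (Set.Ici s) = ENNReal.ofReal ((1 - s) ^ (m + 1)) := by
  have hbeta : 1 / beta 1 ((m + 1 : ℕ) : ℝ) = m + 1 := by
    have hm : ((m + 1 : ℕ) : ℝ) ≠ 0 := by positivity
    rw [beta, add_comm (1 : ℝ), Real.Gamma_add_one hm, Real.Gamma_one]
    have := (Real.Gamma_pos_of_pos (s := ((m + 1 : ℕ) : ℝ)) (by positivity)).ne'
    field_simp
    push_cast; ring
  have hpdf (x : ℝ) : betaPDF 1 ((m + 1 : ℕ) : ℝ) x =
      (Set.Ioo 0 1).indicator (fun x => ENNReal.ofReal ((m + 1) * (1 - x) ^ m)) x := by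
    rw [betaPDF_eq, hbeta]
    simp only [Set.indicator, Set.mem_Ioo]
    split_ifs with hx
    · simp
    · simp
  rw [betaOneLaw, if_neg m.succ_ne_zero, betaMeasure, withDensity_apply _ measurableSet_Ici]
  simp_rw [hpdf]
  rw [lintegral_indicator measurableSet_Ioo, Measure.restrict_restrict measurableSet_Ioo]
  have hae : (Set.Ioo 0 1 ∩ Set.Ici s : Set ℝ) =ᵐ[volume] Set.Ioc s 1 := by
    have : Set.Ioc s 1 = (Set.Ioc 0 1 ∩ Set.Ioi s : Set ℝ) := by
      ext x; simp only [Set.mem_Ioc, Set.mem_inter_iff, Set.mem_Ioi]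
      constructor
      · rintro ⟨a, b⟩; exact ⟨⟨by linarith, b⟩, a⟩
      · rintro ⟨⟨_, b⟩, a⟩; exact ⟨a, b⟩
    rw [this]
    exact Ioo_ae_eq_Ioc.inter Ioi_ae_eq_Ici.symm
  have hcont : Continuous fun x : ℝ => (m + 1) * (1 - x) ^ m := by fun_prop
  rw [Measure.restrict_congr_set hae, ← ofReal_integral_eq_lintegral_ofReal
    (hcont.integrableOn_Ioc) ((ae_restrict_iff' measurableSet_Ioc).2
      (Filter.Eventually.of_forall fun x hx => by
        have : 0 ≤ 1 - x := by linarith [hx.2]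
        positivity)), ← intervalIntegral.integral_of_le h1,
    intervalIntegral.integral_eq_sub_of_hasDerivAt (f := fun x : ℝ => -(1 - x) ^ (m + 1))
      (fun x _ => by
        convert! (((hasDerivAt_id x).const_sub 1).pow (m + 1)).neg using 1
        simp) (hcont.intervalIntegrable _ _)]
  simp

instance isProbabilityMeasure_betaOneLaw (j : ℕ) : IsProbabilityMeasure (betaOneLaw j) := by
  unfold betaOneLaw
  split_ifs with h
  · infer_instance
  · exact isProbabilityMeasureBeta one_pos (by positivity)

/-- Conditionally on the other coordinates, the exponential tail of `|z₀|²` gives `exp (-c ∑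
|zᵢ|²)`; its mean is a product of `n` Laplace transforms. -/
theorem pi_complexGaussian_setOf_mul_sum_le {n : ℕ} {c : ℝ} (hc : 0 ≤ c) :
    (Measure.pi fun _ : Fin (n + 1) => complexGaussian)
      {z | c * ∑ i : Fin n, ‖z i.succ‖ ^ 2 ≤ ‖z 0‖ ^ 2} = ENNReal.ofReal ((1 / (1 + c)) ^ n) := by
  have hS : MeasurableSet {z : Fin (n + 1) → ℂ |
      c * ∑ i : Fin n, ‖z i.succ‖ ^ 2 ≤ ‖z 0‖ ^ 2} :=
    measurableSet_le (by fun_prop) (by fun_prop)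
  have hmp := (measurePreserving_piFinSuccAbove
    (fun _ : Fin (n + 1) => complexGaussian) 0).symm
  rw [← hmp.measure_preimage hS.nullMeasurableSet,
    Measure.prod_apply_symm (hmp.measurable hS)]
  have h (y : Fin n → ℂ) : complexGaussian ((fun x => (x, y)) ⁻¹'
      ((MeasurableEquiv.piFinSuccAbove (fun _ : Fin (n + 1) => ℂ) 0).symm ⁻¹'
        {z | c * ∑ i : Fin n, ‖z i.succ‖ ^ 2 ≤ ‖z 0‖ ^ 2})) =
      ∏ i, ENNReal.ofReal (Real.exp (-(c * ‖y i‖ ^ 2))) := by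
    have : ((fun x => (x, y)) ⁻¹'
      ((MeasurableEquiv.piFinSuccAbove (fun _ : Fin (n + 1) => ℂ) 0).symm ⁻¹'
        {z | c * ∑ i : Fin n, ‖z i.succ‖ ^ 2 ≤ ‖z 0‖ ^ 2})) =
        {x : ℂ | c * ∑ i, ‖y i‖ ^ 2 ≤ ‖x‖ ^ 2} := by
      ext x
      simp [MeasurableEquiv.piFinSuccAbove]
    rw [this, complexGaussian_norm_sq_ge (by positivity),
      ← ENNReal.ofReal_prod_of_nonneg fun _ _ => (Real.exp_pos _).le, ← Real.exp_sum,
      Finset.sum_neg_distrib, Finset.mul_sum]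
  rw [lintegral_congr h]
  change ∫⁻ y, _ ∂(Measure.pi fun _ : Fin n => complexGaussian) = _
  rw [lintegral_fin_prod_eq_prod_lintegral _ (f := fun _ x =>
      ENNReal.ofReal (Real.exp (-(c * ‖x‖ ^ 2)))) fun _ => by fun_prop]
  simp only [lintegral_exp_neg_mul_norm_sq_complexGaussian hc]
  rw [Finset.prod_const, Finset.card_univ, Fintype.card_fin, ENNReal.ofReal_pow (by positivity)]

/-- Tails are compared. For `0 < s < 1` the ratio is at least `s` exactly when `|z₀|²` is at least
`s / (1 - s)` times the sum of the others, an event of probability `(1 - s)ⁿ`. -/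
theorem map_norm_sq_div_pi_complexGaussian (n : ℕ) :
    (Measure.pi fun _ : Fin (n + 1) => complexGaussian).map
      (fun z => ‖z 0‖ ^ 2 / ∑ i, ‖z i‖ ^ 2) = betaOneLaw n := by
  set Γ : Measure (Fin (n + 1) → ℂ) := Measure.pi fun _ => complexGaussian with hΓ
  have hm : Measurable fun z : Fin (n + 1) → ℂ => ‖z 0‖ ^ 2 / ∑ i, ‖z i‖ ^ 2 := by fun_prop
  have hz (i : Fin (n + 1)) : ∀ᵐ z ∂Γ, z i ≠ 0 := by
    rw [ae_iff]
    simpa using Measure.pi_hyperplane (fun _ : Fin (n + 1) => complexGaussian) i 0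
  cases n with
  | zero =>
    -- With a single coordinate the ratio is almost surely 1, matching the Dirac convention.
    have : (fun z : Fin 1 → ℂ => ‖z 0‖ ^ 2 / ∑ i, ‖z i‖ ^ 2) =ᵐ[Γ] fun _ => 1 := by
      filter_upwards [hz 0] with z hz
      simp [hz]
    rw [Measure.map_congr this, Measure.map_const]
    simp [betaOneLaw]
  | succ m =>
    have : IsProbabilityMeasure (Γ.map fun z : Fin (m + 2) → ℂ => ‖z 0‖ ^ 2 / ∑ i, ‖z i‖ ^ 2) :=
      Measure.isProbabilityMeasure_map hm.aemeasurable
    refine Measure.ext_of_Ici _ _ fun s => ?_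
    rw [Measure.map_apply hm measurableSet_Ici]
    rcases le_or_gt s 0 with hs | hs
    · have h1 : betaOneLaw (m + 1) (Set.Ici s) = 1 := by
        refine le_antisymm prob_le_one ?_
        have := betaOneLaw_succ_Ici m le_rfl zero_le_one
        simp only [sub_zero, one_pow, ENNReal.ofReal_one] at this
        rw [← this]
        exact measure_mono (Set.Ici_subset_Ici.2 hs)
      have h2 : (fun z : Fin (m + 2) → ℂ => ‖z 0‖ ^ 2 / ∑ i, ‖z i‖ ^ 2) ⁻¹' Set.Ici s =
          Set.univ := Set.eq_univ_of_forall fun z => hs.trans (by positivity)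
      rw [h1, h2, measure_univ]
    rcases le_or_gt 1 s with h1s | hs1
    · have h1 : betaOneLaw (m + 1) (Set.Ici s) = 0 := by
        refine measure_mono_null (Set.Ici_subset_Ici.2 h1s) ?_
        rw [betaOneLaw_succ_Ici m zero_le_one le_rfl]
        simp
      rw [h1, measure_eq_zero_iff_ae_notMem]
      filter_upwards [hz 1] with z hz1
      rw [Set.mem_preimage, Set.mem_Ici, not_le]
      refine lt_of_lt_of_le ?_ h1s
      have hlt : ‖z 0‖ ^ 2 < ∑ i, ‖z i‖ ^ 2 := by
        rw [Fin.sum_univ_succ]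
        exact lt_add_of_pos_right _ (Finset.sum_pos' (fun i _ => by positivity)
          ⟨0, Finset.mem_univ _, pow_pos (norm_pos_iff.2 hz1) 2⟩)
      exact (div_lt_one ((by positivity : (0 : ℝ) ≤ ‖z 0‖ ^ 2).trans_lt hlt)).2 hlt
    · rw [betaOneLaw_succ_Ici m hs.le hs1.le]
      have h1s : 0 < 1 - s := sub_pos.2 hs1
      have hc : (1 : ℝ) / (1 + s / (1 - s)) = 1 - s := by field_simp; ring
      have := pi_complexGaussian_setOf_mul_sum_le (n := m + 1) (div_nonneg hs.le h1s.le)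
      rw [hc] at this
      rw [← this]
      refine measure_congr ?_
      filter_upwards [hz 0] with z hz0
      have hpos : 0 < ∑ i, ‖z i‖ ^ 2 :=
        Finset.sum_pos' (fun i _ => by positivity) ⟨0, Finset.mem_univ _, by positivity⟩
      refine propext ?_
      change s ≤ ‖z 0‖ ^ 2 / ∑ i, ‖z i‖ ^ 2 ↔
        s / (1 - s) * ∑ i : Fin (m + 1), ‖z i.succ‖ ^ 2 ≤ ‖z 0‖ ^ 2
      rw [le_div_iff₀ hpos, Fin.sum_univ_succ, div_mul_eq_mul_div, div_le_iff₀ h1s]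
      constructor <;> intro h <;> linarith

theorem map_norm_sq_haar_apply_zero {n : ℕ}
    (μ : Measure (Matrix.unitaryGroup (Fin (n + 1)) ℂ)) [μ.IsHaarMeasure]
    [IsProbabilityMeasure μ] :
    μ.map (fun H => ‖H.1 0 0‖ ^ 2) = betaOneLaw n := by
  rw [← map_norm_sq_div_pi_complexGaussian]
  have hm : Measurable fun H : Matrix.unitaryGroup (Fin (n + 1)) ℂ => ‖H.1 0 0‖ ^ 2 :=
    (measurable_unitaryGroup_apply 0 0).norm.pow_const 2
  refine Measure.ext_of_lintegral _ fun f hf => ?_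
  rw [lintegral_map hf hm, lintegral_map hf (by fun_prop),
    lintegral_haar_apply_zero μ (F := fun x => f (‖x‖ ^ 2)) (hf.comp (by fun_prop))]
  refine lintegral_congr fun z => ?_
  rw [norm_div, div_pow, Complex.norm_real, Real.norm_eq_abs, sq_abs,
    Real.sq_sqrt (by positivity)]

/-! ### Uniform phases and the law of one factor -/

/-- Multiplying by `x` shifts the angle by `arg x`, which is harmless by periodicity. The integral
over any window of length `2π` is one over the circle. -/
theorem setLIntegral_Icc_exp_mul_eq {F : ℂ → ℝ≥0∞} (x : ℂ) :
    ∫⁻ t in Set.Icc 0 (2 * Real.pi), F (Complex.exp (Complex.I * (t : ℂ)) * x) =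
      ∫⁻ t in Set.Icc 0 (2 * Real.pi), F (Complex.exp (Complex.I * (t : ℂ)) * (‖x‖ : ℝ)) := by
  have : Fact (0 < 2 * Real.pi) := ⟨Real.two_pi_pos⟩
  have key (a : ℝ) : ∫⁻ t in Set.Ioc a (a + 2 * Real.pi),
      F (Complex.exp (Complex.I * (t : ℂ)) * (‖x‖ : ℝ)) =
      ∫⁻ t : AddCircle (2 * Real.pi), F (AddCircle.toCircle t * (‖x‖ : ℝ)) := by
    rw [← AddCircle.lintegral_preimage (2 * Real.pi) a]
    refine lintegral_congr fun t => ?_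
    rw [AddCircle.toCircle_apply_mk, Circle.coe_exp, div_self Real.two_pi_pos.ne', one_mul,
      mul_comm Complex.I]
  have hpolar (t : ℝ) : Complex.exp (Complex.I * (t : ℂ)) * x =
      Complex.exp (Complex.I * ((t + Complex.arg x : ℝ) : ℂ)) * (‖x‖ : ℝ) := by
    conv_lhs => rw [← Complex.norm_mul_exp_arg_mul_I x]
    rw [Complex.ofReal_add, mul_add, Complex.exp_add, mul_comm Complex.I (Complex.arg x : ℂ)]
    ring
  rw [restrict_Ioc_eq_restrict_Icc.symm]
  have h0 := key 0
  rw [zero_add] at h0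
  rw [h0, ← key (Complex.arg x)]
  simp_rw [hpolar]
  have hmp := (measurePreserving_add_right (volume : Measure ℝ) (Complex.arg x)).restrict_preimage
    (measurableSet_Ioc (a := Complex.arg x) (b := Complex.arg x + 2 * Real.pi))
  rw [← hmp.lintegral_comp_emb (measurableEmbedding_addRight _)]
  simp

/-- The uniform distribution on `[0, 2π]`. -/
noncomputable def uniformAngle : Measure ℝ :=
  ProbabilityTheory.cond volume (Set.Icc 0 (2 * Real.pi))

instance isProbabilityMeasure_uniformAngle : IsProbabilityMeasure uniformAngle :=
  cond_isProbabilityMeasure_of_finite (by simp [Real.pi_pos]) (by simp [ENNReal.mul_eq_top])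

theorem lintegral_uniformAngle_exp_mul {F : ℂ → ℝ≥0∞} (x : ℂ) :
    ∫⁻ t, F (Complex.exp (Complex.I * (t : ℂ)) * x) ∂uniformAngle =
      ∫⁻ t, F (Complex.exp (Complex.I * (t : ℂ)) * (‖x‖ : ℝ)) ∂uniformAngle := by
  simp only [uniformAngle, ProbabilityTheory.cond, lintegral_smul_measure]
  rw [setLIntegral_Icc_exp_mul_eq]

/-- The factor `1 + e^{it} √b`. -/
noncomputable def angleBetaFactor (p : ℝ × ℝ) : ℂ :=
  1 + Complex.exp (Complex.I * (p.1 : ℂ)) * ((Real.sqrt p.2 : ℝ) : ℂ)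

@[fun_prop]
theorem measurable_angleBetaFactor : Measurable angleBetaFactor := by
  unfold angleBetaFactor; fun_prop

/-- The law of `1 + e^{iT} √β_{1,j}` with `T` uniform on `[0, 2π]` independent of `β_{1,j}`. -/
noncomputable def factorLaw (j : ℕ) : Measure ℂ :=
  (uniformAngle.prod (betaOneLaw j)).map angleBetaFactor

instance isProbabilityMeasure_factorLaw (j : ℕ) : IsProbabilityMeasure (factorLaw j) :=
  Measure.isProbabilityMeasure_map measurable_angleBetaFactor.aemeasurable

/-- Averaging over scalar multiples `-e^{it} H` supplies a uniform phase independent of `H`; it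
swallows the phase of `H₀₀`, so only `|H₀₀|²` remains. -/
theorem lintegral_one_sub_haar_apply_zero {n : ℕ}
    (μ : Measure (Matrix.unitaryGroup (Fin (n + 1)) ℂ)) [μ.IsHaarMeasure] [IsProbabilityMeasure μ]
    {F : ℂ → ℝ≥0∞} (hF : Measurable F) :
    ∫⁻ H, F (1 - H.1 0 0) ∂μ = ∫⁻ x, F x ∂(factorLaw n) := by
  have hH : Measurable fun H : Matrix.unitaryGroup (Fin (n + 1)) ℂ => H.1 0 0 :=
    measurable_unitaryGroup_apply 0 0
  calc ∫⁻ H, F (1 - H.1 0 0) ∂μ = ∫⁻ _, ∫⁻ H, F (1 - H.1 0 0) ∂μ ∂uniformAngle := by simp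
    _ = ∫⁻ t, ∫⁻ H, F (1 + Complex.exp (Complex.I * (t : ℂ)) * H.1 0 0) ∂μ ∂uniformAngle := by
        refine lintegral_congr fun t => ?_
        obtain ⟨S, hS⟩ := exists_unitaryGroup_mul_eq_smul (n := n + 1)
          (c := -Complex.exp (Complex.I * (t : ℂ))) (by
            rw [norm_neg, mul_comm, Complex.norm_exp_ofReal_mul_I])
        rw [← lintegral_mul_left_eq_self (μ := μ) (fun H => F (1 - H.1 0 0)) S]
        simp_rw [hS]
        simp
    _ = ∫⁻ H, ∫⁻ t, F (1 + Complex.exp (Complex.I * (t : ℂ)) * H.1 0 0) ∂uniformAngle ∂μ := by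
        rw [lintegral_lintegral_swap]
        refine (hF.comp (Measurable.const_add (Measurable.mul ?_ ?_) 1)).aemeasurable
        · fun_prop
        · exact hH.comp measurable_snd
    _ = ∫⁻ H, ∫⁻ t, F (angleBetaFactor (t, ‖H.1 0 0‖ ^ 2)) ∂uniformAngle ∂μ := by
        refine lintegral_congr fun H => ?_
        rw [lintegral_uniformAngle_exp_mul (F := fun x => F (1 + x))]
        simp [angleBetaFactor]
    _ = ∫⁻ b, ∫⁻ t, F (angleBetaFactor (t, b)) ∂uniformAngle ∂(betaOneLaw n) := by
        rw [← map_norm_sq_haar_apply_zero μ, lintegral_map _ (hH.norm.pow_const 2)]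
        exact (hF.comp measurable_angleBetaFactor).lintegral_prod_left'
    _ = ∫⁻ x, F x ∂(factorLaw n) := by
        rw [factorLaw, lintegral_map hF measurable_angleBetaFactor]
        exact (lintegral_prod_symm' _ (hF.comp measurable_angleBetaFactor)).symm

/-! ### Products of independent factors -/

/-- The law of the product of `N` independent factors `1 + e^{iθ_k} √β_{1,k}`, `k < N`. -/
noncomputable def factorProdLaw : ℕ → Measure ℂ
  | 0 => Measure.dirac 1
  | n + 1 => ((factorProdLaw n).prod (factorLaw n)).map fun p => p.1 * p.2

instance isProbabilityMeasure_factorProdLaw (n : ℕ) :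
    IsProbabilityMeasure (factorProdLaw n) := by
  induction n with
  | zero => unfold factorProdLaw; infer_instance
  | succ n ih =>
    unfold factorProdLaw
    exact Measure.isProbabilityMeasure_map (by fun_prop)

/-- Induction on the dimension; the empty determinant 1 accounts for the Dirac mass at the start. -/
theorem map_det_one_sub_haar (n : ℕ)
    (μ : Measure (Matrix.unitaryGroup (Fin n) ℂ)) [μ.IsHaarMeasure] [IsProbabilityMeasure μ] :
    μ.map (fun V => (1 - V.1).det) = factorProdLaw n := by
  induction n with
  | zero =>
    simp [factorProdLaw, Measure.map_const]
  | succ n ih =>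
    obtain ⟨ν, _, _⟩ := exists_isHaarMeasure_isProbabilityMeasure_unitaryGroup n
    refine Measure.ext_of_lintegral _ fun F hF => ?_
    have hmul : Measurable fun p : ℂ × ℂ => p.1 * p.2 := by fun_prop
    have hFm : Measurable fun p : ℂ × ℂ => F (p.1 * p.2) := hF.comp hmul
    have hFd (x : ℂ) : Measurable fun y => F (y * x) := hF.comp (by fun_prop)
    rw [lintegral_map hF (measurable_det_one_sub _), lintegral_det_one_sub_haar_succ μ ν hF,
      factorProdLaw, lintegral_map hF hmul, lintegral_prod_symm' _ hFm,
      ← lintegral_one_sub_haar_apply_zero μ hFm.lintegral_prod_left']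
    refine lintegral_congr fun H => ?_
    rw [← ih ν, lintegral_map (hFd _) (measurable_det_one_sub _)]
    simp_rw [mul_comm]

theorem map_prod_eq_factorProdLaw {Ω : Type*} [MeasurableSpace Ω] {P : Measure Ω}
    [IsProbabilityMeasure P] (n : ℕ) {X : Fin n → Ω → ℂ} (hm : ∀ k, Measurable (X k))
    (hX : ∀ k, P.map (X k) = factorLaw k) (hi : iIndepFun X P) :
    P.map (fun ω => ∏ k, X k ω) = factorProdLaw n := by
  induction n with
  | zero => simp [factorProdLaw, Measure.map_const]
  | succ n ih =>
    have hmp : Measurable fun ω => ∏ k : Fin n, X k.castSucc ω :=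
      Finset.measurable_fun_prod _ fun k _ => hm _
    have hprod := ih (fun k => hm k.castSucc) (fun k => hX k.castSucc)
      (hi.precomp (Fin.castSucc_injective n))
    have hind : IndepFun (fun ω => ∏ k : Fin n, X k.castSucc ω) (X (Fin.last n)) P := by
      have := hi.indepFun_finsetProd_of_notMem hm
        (s := Finset.univ.map Fin.castSuccEmb) (i := Fin.last n) (by simp [Fin.castSucc_ne_last])
      rw [Finset.prod_map] at this
      convert! this using 1
      ext ω
      simp
    have hpair := (indepFun_iff_map_prod_eq_prod_map_map hmp.aemeasurable
      (hm (Fin.last n)).aemeasurable).1 hind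
    simp_rw [Fin.prod_univ_castSucc]
    have hlast : P.map (X (Fin.last n)) = factorLaw n := hX (Fin.last n)
    rw [factorProdLaw, ← hprod, ← hlast, ← hpair, Measure.map_map (by fun_prop) (hmp.prodMk (hm _))]
    rfl

theorem map_prod_angleBetaFactor_pi (n : ℕ) :
    (Measure.pi fun k : Fin n => uniformAngle.prod (betaOneLaw k)).map
      (fun x => ∏ k, angleBetaFactor (x k)) = factorProdLaw n := by
  have hlaw (k : Fin n) : (Measure.pi fun k : Fin n => uniformAngle.prod (betaOneLaw k)).map
      (fun x => angleBetaFactor (x k)) = factorLaw k := by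
    have h := (measurePreserving_eval
      (fun k : Fin n => uniformAngle.prod (betaOneLaw k)) k).map_eq
    rw [factorLaw, ← h, Measure.map_map measurable_angleBetaFactor (measurable_pi_apply k)]
    rfl
  have hi : iIndepFun (fun (k : Fin n) (x : Fin n → ℝ × ℝ) => angleBetaFactor (x k))
      (Measure.pi fun k : Fin n => uniformAngle.prod (betaOneLaw k)) :=
    iIndepFun_pi fun _ => measurable_angleBetaFactor.aemeasurable
  exact map_prod_eq_factorProdLaw n
    (fun k => measurable_angleBetaFactor.comp (measurable_pi_apply k)) hlaw hi

/-- Joint independence of the whole family makes its law a product measure, which is then regrouped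
into pairs. -/
theorem map_prodMk_eq_pi_prod {Ω : Type*} [MeasurableSpace Ω] {P : Measure Ω}
    [IsProbabilityMeasure P] {ι : Type*} [Fintype ι] {α : Type*} [MeasurableSpace α]
    {X Y : ι → Ω → α} (hX : ∀ k, AEMeasurable (X k) P) (hY : ∀ k, AEMeasurable (Y k) P)
    (hindep : iIndepFun (Sum.elim X Y) P) :
    P.map (fun ω k => (X k ω, Y k ω)) =
      Measure.pi fun k => (P.map (X k)).prod (P.map (Y k)) := by
  have hm : ∀ i, AEMeasurable (Sum.elim X Y i) P := by
    rintro (i | i)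
    · exact hX i
    · exact hY i
  have hprob : ∀ i, IsProbabilityMeasure (P.map (Sum.elim X Y i)) :=
    fun i => Measure.isProbabilityMeasure_map (hm i)
  have hprobX : ∀ i, IsProbabilityMeasure (P.map (X i)) :=
    fun i => Measure.isProbabilityMeasure_map (hX i)
  have hprobY : ∀ i, IsProbabilityMeasure (P.map (Y i)) :=
    fun i => Measure.isProbabilityMeasure_map (hY i)
  have h1 := (iIndepFun_iff_map_fun_eq_pi_map hm).1 hindep
  have h2 := (measurePreserving_sumPiEquivProdPi fun i => P.map (Sum.elim X Y i)).map_eq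
  have h3 := (measurePreserving_arrowProdEquivProdArrow α α ι (fun k => P.map (X k))
    (fun k => P.map (Y k))).symm.map_eq
  rw [← h3]
  simp only [Sum.elim_inl, Sum.elim_inr] at h2
  rw [← h2, ← h1, AEMeasurable.map_map_of_aemeasurable (by fun_prop) (aemeasurable_pi_lambda _ hm),
    AEMeasurable.map_map_of_aemeasurable (by fun_prop)
      ((MeasurableEquiv.measurable _).comp_aemeasurable (aemeasurable_pi_lambda _ hm))]
  rfl

theorem proposition2p2 (N : ℕ)
    -- the Haar probability measure on `U(N)`
    (μ : Measure (Matrix.unitaryGroup (Fin N) ℂ)) [μ.IsHaarMeasure] [IsProbabilityMeasure μ]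
    -- a random unitary matrix with this law
    {Ω : Type*} [MeasurableSpace Ω] (P : Measure Ω) [IsProbabilityMeasure P]
    (V : Ω → Matrix.unitaryGroup (Fin N) ℂ) (hV : HasLaw V μ P)
    -- independent random variables; `b k` stands for `β_{1,k}` and `t k` for `θ_{k+1}`,
    -- where `0 ≤ k < N`
    {Ω' : Type*} [MeasurableSpace Ω'] (P' : Measure Ω') [IsProbabilityMeasure P']
    (t b : Fin N → Ω' → ℝ)
    (ht : ∀ k, pdf.IsUniform (t k) (Set.Icc 0 (2 * Real.pi)) P')
    (hb : ∀ k, HasLaw (b k) (betaOneLaw (k : ℕ)) P')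
    (hindep : iIndepFun (Sum.elim t b) P')
    (θ : ℝ) :
    IdentDistrib
      (fun ω => (1 - Complex.exp (Complex.I * (θ : ℂ)) •
        (V ω : Matrix (Fin N) (Fin N) ℂ)).det)
      (fun ω' => ∏ k : Fin N,
        (1 + Complex.exp (Complex.I * (t k ω' : ℂ)) * ((Real.sqrt (b k ω') : ℝ) : ℂ)))
      P P' := by
  obtain ⟨S, hS⟩ := exists_unitaryGroup_mul_eq_smul (n := N)
    (c := Complex.exp (Complex.I * (θ : ℂ))) (by
      rw [mul_comm, Complex.norm_exp_ofReal_mul_I])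
  have htm (k : Fin N) : AEMeasurable (t k) P' :=
    (ht k).aemeasurable (by simp [Real.pi_pos]) (by simp [ENNReal.mul_eq_top])
  have hbm (k : Fin N) : AEMeasurable (b k) P' := (hb k).aemeasurable
  have hdet : Measurable fun U : Matrix.unitaryGroup (Fin N) ℂ => (1 - (S * U).1).det :=
    (measurable_det_one_sub N).comp (measurable_const_mul S)
  have hleft : (fun ω => (1 - Complex.exp (Complex.I * (θ : ℂ)) •
      (V ω : Matrix (Fin N) (Fin N) ℂ)).det) = (fun U => (1 - (S * U).1).det) ∘ V := by
    funext ω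
    rw [Function.comp_apply, hS]
  have hprod : Measurable fun x : Fin N → ℝ × ℝ => ∏ k, angleBetaFactor (x k) := by fun_prop
  have hpair : AEMeasurable (fun ω' k => (t k ω', b k ω')) P' :=
    aemeasurable_pi_lambda _ fun k => (htm k).prodMk (hbm k)
  have hright : (fun ω' => ∏ k : Fin N,
      (1 + Complex.exp (Complex.I * (t k ω' : ℂ)) * ((Real.sqrt (b k ω') : ℝ) : ℂ))) =
      (fun x : Fin N → ℝ × ℝ => ∏ k, angleBetaFactor (x k)) ∘
        fun ω' k => (t k ω', b k ω') := rfl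
  rw [hleft, hright]
  refine ⟨hdet.comp_aemeasurable hV.aemeasurable, hprod.comp_aemeasurable hpair, ?_⟩
  have htlaw (k : Fin N) : P'.map (t k) = uniformAngle := ht k
  rw [← AEMeasurable.map_map_of_aemeasurable hdet.aemeasurable hV.aemeasurable, hV.map_eq,
    ← AEMeasurable.map_map_of_aemeasurable hprod.aemeasurable hpair,
    map_prodMk_eq_pi_prod htm hbm hindep]
  simp_rw [htlaw, fun k => (hb k).map_eq]
  rw [map_prod_angleBetaFactor_pi, ← map_det_one_sub_haar N μ]
  -- Invariance under the scalar matrix `S = e^{iθ} I` restores the phase `θ`.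
  conv_rhs => rw [← map_mul_left_eq_self μ S]
  rw [Measure.map_map (measurable_det_one_sub N) (measurable_const_mul S)]
  rfl
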